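/- All functions are smooth, $(i,j,k)$ runs through the cyclic permutations of $(1,2,3)$, and $(\varepsilon_1,\varepsilon_2,\varepsilon_3)=(1,1,-1)$. Let $U\subseteq\mathbb R^3$ be open and connected. A triply orthogonal system on $U$ is a map $f:U\to\mathbb R^3$ with $\det(\partial_1 f,\partial_2 f,\partial_3 f)\neq 0$ and $(\partial_i f,\partial_j f)=0$ for $i\ne j$. Its unit normals are $N_i=\frac{\partial_j f\times\partial_k f}{|\partial_j f\times\partial_k f|}$, its Lam\'e coefficients $H_i$ are defined by $\partial_i f=H_iN_i$, and it is a Guichard net if $H_1^2+H_2^2-H_3^2=0$. For an open set $V\subseteq U$, a Combescure transform of $f$ on $V$ is a map $\hat f:V\to\mathbb R^3$ with $\partial_i\hat f=h_i\,\partial_i f$ for functions $h_1,h_2,h_3$ on $V$ (zeros of the $h_i$ are allowed, that is, $\hat f$ may degenerate); its Lam\'e coefficients with respect to the common normals $N_i$ are $\hat H_i=h_iH_i$, so $\partial_i\hat f=\hat H_iN_i$. Consider the relations $$H_i\hat H_j-H_j\hat H_i=\varepsilon_kH_k\qquad\text{for all cyclic }(i,j,k).\tag{$*$}$$ **Theorem.**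 Let $f$ be a triply orthogonal system on $U$ with Lam\'e coefficients $H_1,H_2,H_3$. 1. If $U$ is simply connected, then $f$ is a Guichard net if and only if there is a Combescure transform $\hat f$ of $f$ on $U$ that satisfies $(*)$. 2. For arbitrary (open, connected) $U$, if there is a Combescure transform of $f$ on $U$ that satisfies $(*)$, then $f$ is a Guichard net. 3. For arbitrary (open, connected) $U$, $f$ is a Guichard net if and only if every point of $U$ has a connected open neighbourhood $V\subseteq U$ on which there is a Combescure transform $\hat f$ of $f$ that is itself a (non-degenerate) triply orthogonal system with the same unit normals $N_i$ as $f$ and satisfies $(*)$. 4. If $V\subseteq U$ is open and simply connected and $\hat f$ is a Combescure transform of $f$ on $V$ that satisfies $(*)$, then $\hat f$ is an associated system of $f$ on $V$. Here $\hat f$ is an *associated system* of $f$ on $V$ if there is a further Combescure transform $f^\star$ of $f$ on $V$ (a dual system), $\partial_i f^\star=h_i^\star\,\partial_i f$, such that, for all cyclic $(i,j,k)$, the principal curvatures of the coordinate surfaces $x_i=\mathrm{const}$ (with respect to $N_i$, in the directions $x_j$ and $x_k$) satisfy $$\frac1{\kappa_{ij}\kappa^\star_{ik}}+\frac1{\kappa_{ik}\kappa^\star_{ij}}=-\frac2{\hat\kappa_{ij}\hat\kappa_{ik}},$$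 and the pair $(\hat f,f^\star)$ is non-trivial at every point of every coordinate surface: $\kappa_{ij}\kappa_{ij}^\star\neq-\hat\kappa_{ij}^2$ or $\kappa_{ik}\kappa_{ik}^\star\neq-\hat\kappa_{ik}^2$. The radius of principal curvature of a Combescure transform is taken to be $0$ where the transform degenerates in the direction concerned; the curvature relation holds literally wherever $\kappa_{ij}\kappa_{ik}\ne0$ and everywhere in the form multiplied by $\kappa_{ij}\kappa_{ik}$, that is, with $h_j=\kappa_{ij}/\hat\kappa_{ij}$ and $h^\star_j=\kappa_{ij}/\kappa^\star_{ij}$, as $h^\star_j+h^\star_k=-2h_jh_k$; likewise non-triviality means $h_j^\star\ne-h_j^2$ or $h_k^\star\neq-h_k^2$. -/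

import Mathlib

open scoped ContDiff

noncomputable section

namespace TriplyOrthogonal

/-- Euclidean three-space. -/
abbrev E3 : Type := EuclideanSpace ℝ (Fin 3)

/-- The partial derivative `∂ᵢ f` at `x`. -/
def pd (f : E3 → E3) (i : Fin 3) (x : E3) : E3 :=
  fderiv ℝ f x (EuclideanSpace.single i 1)

/-- The cross product of Euclidean three-space. -/
def cross (v w : E3) : E3 := WithLp.toLp 2 (crossProduct v.ofLp w.ofLp)

/-- The determinant `det (∂₁ f, ∂₂ f, ∂₃ f)`. -/
def jacobianDet (f : E3 → E3) (x : E3) : ℝ :=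
  (Matrix.of fun a i : Fin 3 => pd f i x a).det

/-- `f` is a (smooth) triply orthogonal system on the open connected set `U`. -/
structure IsTriplyOrthogonalSystem (U : Set E3) (f : E3 → E3) : Prop where
  isOpen : IsOpen U
  isConnected : IsConnected U
  smooth : ContDiffOn ℝ ∞ f U
  det_ne_zero : ∀ x ∈ U, jacobianDet f x ≠ 0
  orthogonal : ∀ x ∈ U, ∀ i j : Fin 3, i ≠ j → inner ℝ (pd f i x) (pd f j x) = 0

/-- The unit normal `Nᵢ = ∂ⱼ f × ∂ₖ f / |∂ⱼ f × ∂ₖ f|` of the coordinate surfaces `xᵢ = const`,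
where `(i, j, k)` is cyclic. -/
def unitNormal (f : E3 → E3) (i : Fin 3) (x : E3) : E3 :=
  ‖cross (pd f (i + 1) x) (pd f (i + 2) x)‖⁻¹ • cross (pd f (i + 1) x) (pd f (i + 2) x)

/-- The Lamé coefficients of `g` with respect to the unit normals `N₁, N₂, N₃` of `f`.
If `g` is a Combescure transform of `f`, then `f` and `g` have these normals in common, and the
coefficients are the functions `Ĥᵢ` with `∂ᵢ g = Ĥᵢ Nᵢ`. -/
def lameAlong (f g : E3 → E3) (i : Fin 3) (x : E3) : ℝ :=
  inner ℝ (pd g i x) (unitNormal f i x)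

/-- The Lamé coefficients `Hᵢ` of a triply orthogonal system `f`: `∂ᵢ f = Hᵢ Nᵢ`. -/
def lame (f : E3 → E3) (i : Fin 3) (x : E3) : ℝ := lameAlong f f i x

/-- The signs `(ε₁, ε₂, ε₃) = (1, 1, -1)`. -/
def eps : Fin 3 → ℝ := ![1, 1, -1]

/-- A Guichard net: a triply orthogonal system with `H₁² + H₂² - H₃² = 0`. -/
def IsGuichardNet (U : Set E3) (f : E3 → E3) : Prop :=
  IsTriplyOrthogonalSystem U f ∧
    ∀ x ∈ U, lame f 0 x ^ 2 + lame f 1 x ^ 2 - lame f 2 x ^ 2 = 0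

/-- `g` is a Combescure transform of the triply orthogonal system `f` on `U`:
corresponding coordinate surfaces have parallel tangent directions along corresponding
(curvature line) coordinates, `∂ᵢ g = hᵢ ∂ᵢ f`. The functions `hᵢ` may have zeros, that is,
`g` may degenerate. -/
def IsCombescureTransform (U : Set E3) (f g : E3 → E3) : Prop :=
  ContDiffOn ℝ ∞ g U ∧
    ∃ h : Fin 3 → E3 → ℝ, ∀ x ∈ U, ∀ i : Fin 3, pd g i x = h i x • pd f i x

/-- The relations `Hᵢ Ĥⱼ - Hⱼ Ĥᵢ = εₖ Hₖ` for `(i, j, k)` cyclic. -/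
def LameRelation (U : Set E3) (f g : E3 → E3) : Prop :=
  ∀ x ∈ U, ∀ i : Fin 3,
    lame f i x * lameAlong f g (i + 1) x - lame f (i + 1) x * lameAlong f g i x
      = eps (i + 2) * lame f (i + 2) x

/-- The principal curvature `κᵢⱼ`, in the direction `xⱼ`, of the coordinate surfaces `xᵢ = const`
of `g`, with respect to the normal `Nᵢ` of `f`: `∂ⱼ Nᵢ = - κᵢⱼ ∂ⱼ g` (Rodrigues' formula).
It is used for `g = f` and for Combescure transforms `g` of `f`. -/
def principalCurvature (f g : E3 → E3) (i j : Fin 3) (x : E3) : ℝ :=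
  - inner ℝ (pd (unitNormal f i) j x) (pd g j x) / ‖pd g j x‖ ^ 2

open Classical in
/-- The radius of principal curvature `1 / κᵢⱼ`; by convention it is zero where the coordinate
surface of `g` degenerates in the direction `xⱼ`. -/
def curvatureRadius (f g : E3 → E3) (i j : Fin 3) (x : E3) : ℝ :=
  if pd g j x = 0 then 0 else (principalCurvature f g i j x)⁻¹

/-- The function `hᵢ = Ĥᵢ / Hᵢ` that describes a Combescure transform `g` of `f` through
`∂ᵢ g = hᵢ ∂ᵢ f`. On the coordinate surfaces `xⱼ = const`, `j ≠ i`, it is the quotient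
`κⱼᵢ / κ̂ⱼᵢ` of the principal curvatures of `f` and `g`, and it also makes sense where these
vanish or where `g` degenerates. -/
def combFactor (f g : E3 → E3) (i : Fin 3) (x : E3) : ℝ := lameAlong f g i x / lame f i x

/-- The relation `1 / (κᵢⱼ κ⋆ᵢₖ) + 1 / (κᵢₖ κ⋆ᵢⱼ) = - 2 / (κ̂ᵢⱼ κ̂ᵢₖ)` between the principal
curvatures of the coordinate surfaces of `f` and of its Combescure transforms `g` (hat) and
`s` (star), `(i, j, k)` cyclic: literally wherever `κᵢⱼ` and `κᵢₖ` do not vanish, and everywhere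
(in particular for planar or developable coordinate surfaces) in the form obtained by multiplying
with `κᵢⱼ κᵢₖ`. -/
def CurvatureRelation (U : Set E3) (f g s : E3 → E3) : Prop :=
  ∀ x ∈ U, ∀ i : Fin 3,
    (principalCurvature f f i (i + 1) x ≠ 0 → principalCurvature f f i (i + 2) x ≠ 0 →
      curvatureRadius f f i (i + 1) x * curvatureRadius f s i (i + 2) x
        + curvatureRadius f f i (i + 2) x * curvatureRadius f s i (i + 1) x
        = - 2 * (curvatureRadius f g i (i + 1) x * curvatureRadius f g i (i + 2) x)) ∧
    combFactor f s (i + 2) x + combFactor f s (i + 1) x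
      = - 2 * (combFactor f g (i + 1) x * combFactor f g (i + 2) x)

/-- The pair `(g, s)` of Combescure transforms of `f` is non-trivial on every coordinate surface:
`κᵢⱼ κ⋆ᵢⱼ ≠ - κ̂ᵢⱼ²` or `κᵢₖ κ⋆ᵢₖ ≠ - κ̂ᵢₖ²`, written with the quotients
`κᵢⱼ / κ⋆ᵢⱼ` and `κᵢⱼ / κ̂ᵢⱼ`. -/
def IsNontrivialPair (U : Set E3) (f g s : E3 → E3) : Prop :=
  ∀ x ∈ U, ∀ i : Fin 3,
    combFactor f s (i + 1) x ≠ - combFactor f g (i + 1) x ^ 2 ∨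
    combFactor f s (i + 2) x ≠ - combFactor f g (i + 2) x ^ 2

/-- `g` is an associated system of the triply orthogonal system `f` on `U` (and so `f` is a
G-system): together with a further Combescure transform `s` of `f`, the dual system, it forms a
non-trivial pair that satisfies the curvature relation. -/
def IsAssociatedSystem (U : Set E3) (f g : E3 → E3) : Prop :=
  IsTriplyOrthogonalSystem U f ∧ IsCombescureTransform U f g ∧
    ∃ s : E3 → E3, IsCombescureTransform U f s ∧ IsNontrivialPair U f g s ∧
      CurvatureRelation U f g s

end TriplyOrthogonal

end

open scoped ContDiff

noncomputable section

namespace TriplyOrthogonal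

open Set Topology

/-! Write H, Ĥ for the vectors of Lamé coefficients and εH for the vector with entries εᵢHᵢ. The
relations (∗) are the pointwise equation H × Ĥ = εH. Since H ≠ 0, it is solvable exactly when εH ⊥
H, which is the Guichard condition, and the solutions are then G + φH with G = (εH × H)/|H|² and φ
an arbitrary function. It remains to choose φ so that G + φH belongs to a Combescure transform.

Lamé coefficients of Combescure transforms satisfy the linear system ∂ⱼGᵢ = βᵢⱼGⱼ (i ≠ j), and on
simply connected domains every solution integrates to a transform (`isCombescureSolution_lameAlong`,
`exists_combescure`). For G + φH the system reads Hᵢ ∂ₖφ = βᵢₖGₖ - ∂ₖGᵢ. For each k these are two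
equations for ∂ₖφ; they agree by the derivatives of (∗) and of the Guichard condition
(`relation_deriv`). The resulting one-form is closed by Lamé's equations
(`partialDeriv_correction_comm`), so the Poincaré lemma supplies φ. Adding cf to the transform
preserves (∗) and, for large c, removes degeneracies near a point.

The dual system has Lamé coefficients H⋆ᵢ = (εᵢ - Ĥᵢ²)/Hᵢ. Squaring (∗) and using the Guichard
condition (`relation_sq`) gives HᵢH⋆ⱼ + HⱼH⋆ᵢ = -2ĤᵢĤⱼ. This is the curvature relation, and it is
also what makes H⋆ a solution of the linear system. -/

/-! ### Closed one-forms on simply connected domains -/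

/-- Functions on the members of an open cover of a simply connected space that differ by locally
constant functions glue to a global function, up to locally constant functions. -/
theorem exists_glue_of_isLocallyConstant_sub {X A : Type*} [TopologicalSpace X]
    [SimplyConnectedSpace X] [LocallyPathConnectedSpace X] [AddCommGroup A]
    (V : X → Set X) (hVo : ∀ i, IsOpen (V i)) (hV : ∀ i, i ∈ V i) (f : X → X → A)
    (hf : ∀ i j, ∀ x ∈ V i ∩ V j, ∀ y ∈ V i ∩ V j, f i x - f j x = f i y - f j y) :
    ∃ h : X → A, ∀ i, ∀ x ∈ V i, ∀ᶠ y in 𝓝 x, h y - f i y = h x - f i x := by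
  -- With discrete fibre A and translations by the constants `f i - f j` as transition maps, the
  -- local functions define a covering space.
  let _ : TopologicalSpace A := ⊥
  have _ : DiscreteTopology A := ⟨rfl⟩
  let Z : FiberBundleCore X X A :=
    { baseSet := V
      isOpen_baseSet := hVo
      indexAt := id
      mem_baseSet_at := hV
      coordChange := fun i j x v => v + (f i x - f j x)
      coordChange_self := by intro i x _ v; simp
      continuousOn_coordChange := by
        intro i j
        rintro ⟨x, v⟩ ⟨hx, -⟩
        have h1 : ContinuousOn (fun p : X × A => p.2 + (f i x - f j x))
            ((V i ∩ V j) ×ˢ univ) :=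
          ((continuous_of_discreteTopology (f := fun a : A => a + (f i x - f j x))).comp
            continuous_snd).continuousOn
        refine (h1.congr ?_) (x, v) ⟨hx, mem_univ _⟩
        rintro ⟨y, w⟩ ⟨hy, -⟩
        simp only
        rw [hf i j y hy x hx]
      coordChange_comp := by
        intro i j k x _ v
        abel }
  have cov : IsCoveringMap Z.proj := FiberBundle.isCoveringMap (F := A) (E := Z.Fiber)
  obtain ⟨x₀⟩ : Nonempty X := inferInstance
  -- Lifting the identity of the simply connected base gives a global section; read in the chart
  -- `i`, it is locally constant and equals `h - f i`.
  obtain ⟨s, ⟨-, hs⟩, -⟩ := cov.existsUnique_continuousMap_lifts (ContinuousMap.id X) x₀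
    (⟨x₀, (0 : A)⟩ : Z.TotalSpace) rfl
  have hsx : ∀ x, (s x).1 = x := fun x => congrFun hs x
  refine ⟨fun x => (show A from (s x).2) + f x x, fun i x hx => ?_⟩
  have key : ∀ y, (((Z.localTriv i) (s y)).2 : A) = (show A from (s y).2) + (f y y - f i y) := by
    intro y
    have h := congrArg Prod.snd (Z.localTriv_apply i (s y))
    rw [h]
    change (show A from (s y).2) + (f (s y).1 (s y).1 - f i (s y).1) = _
    rw [hsx y]
  have hcont : ContinuousAt (fun y => ((Z.localTriv i) (s y)).2) x := by
    have hmem : s x ∈ (Z.localTriv i).source := by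
      rw [Z.mem_localTriv_source, hsx x]; exact hx
    exact continuous_snd.continuousAt.comp
      (((Z.localTriv i).continuousAt hmem).comp s.continuous.continuousAt)
  have hev := hcont.preimage_mem_nhds
    ((isOpen_discrete {((Z.localTriv i) (s x)).2}).mem_nhds rfl)
  filter_upwards [hev] with y hy
  have h1 : ((Z.localTriv i) (s y)).2 = ((Z.localTriv i) (s x)).2 := hy
  rw [key, key] at h1
  rw [add_sub_assoc, add_sub_assoc]
  exact h1

/-- The Poincaré lemma: a closed one-form on a simply connected open set is exact. -/
theorem exists_primitive_of_isSimplyConnected {E F : Type*} [NormedAddCommGroup E]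
    [NormedSpace ℝ E] [NormedAddCommGroup F] [NormedSpace ℝ F] [CompleteSpace F]
    {U : Set E} (hUo : IsOpen U) (hUs : IsSimplyConnected U) {η : E → E →L[ℝ] F}
    (hη : DifferentiableOn ℝ η U)
    (hdη : ∀ a ∈ U, ∀ x y, fderiv ℝ η a x y = fderiv ℝ η a y x) :
    ∃ f : E → F, ∀ a ∈ U, HasFDerivAt f (η a) a := by
  classical
  have := hUs.simplyConnectedSpace
  have := hUo.locallyPathConnectedSpace
  have hloc : ∀ x : U, ∃ r > 0, Metric.ball (x : E) r ⊆ U := fun x =>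
    Metric.isOpen_iff.1 hUo x x.2
  choose r hr hrU using hloc
  have hprim : ∀ x : U, ∃ f : E → F, ∀ a ∈ Metric.ball (x : E) (r x), HasFDerivAt f (η a) a :=
    fun x => (convex_ball _ _).exists_forall_hasFDerivAt_of_fderiv_symmetric Metric.isOpen_ball
      (hη.mono (hrU x)) fun a ha => hdη a (hrU x ha)
  choose f hf using hprim
  obtain ⟨h, hh⟩ := exists_glue_of_isLocallyConstant_sub (X := U)
    (fun x => (Subtype.val ⁻¹' Metric.ball (x : E) (r x) : Set U))
    (fun x => Metric.isOpen_ball.preimage continuous_subtype_val)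
    (fun x => Metric.mem_ball_self (hr x)) (fun i y => f i y) (by
      intro i j x hx y hy
      -- The overlap of two balls is convex, hence connected, so two primitives differ there by a
      -- single constant.
      have hc : Convex ℝ (Metric.ball (i : E) (r i) ∩ Metric.ball (j : E) (r j)) :=
        (convex_ball _ _).inter (convex_ball _ _)
      have ho : IsOpen (Metric.ball (i : E) (r i) ∩ Metric.ball (j : E) (r j)) :=
        Metric.isOpen_ball.inter Metric.isOpen_ball
      have hd : ∀ a ∈ Metric.ball (i : E) (r i) ∩ Metric.ball (j : E) (r j),
          HasFDerivAt (fun z => f i z - f j z) (0 : E →L[ℝ] F) a := fun a ha => by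
        simpa using (hf i a ha.1).fun_sub (hf j a ha.2)
      exact ho.is_const_of_fderiv_eq_zero hc.isPreconnected
        (fun a ha => (hd a ha).differentiableAt.differentiableWithinAt)
        (fun a ha => (hd a ha).fderiv) hx hy)
  refine ⟨fun x => if hx : x ∈ U then h ⟨x, hx⟩ else 0, fun a ha => ?_⟩
  have hev := hh ⟨a, ha⟩ ⟨a, ha⟩ (Metric.mem_ball_self (hr _))
  have hd : HasFDerivAt (fun y => f ⟨a, ha⟩ y + (h ⟨a, ha⟩ - f ⟨a, ha⟩ a)) (η a) a :=
    (hf ⟨a, ha⟩ a (Metric.mem_ball_self (hr _))).add_const _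
  refine hd.congr_of_eventuallyEq ?_
  rw [nhds_subtype_eq_comap, Filter.eventually_comap] at hev
  filter_upwards [hev, hUo.mem_nhds ha] with y hy hyU
  rw [dif_pos hyU, ← hy ⟨y, hyU⟩ rfl]
  abel

/-! ### Partial derivatives on Euclidean three-space -/

section Calculus

variable {F : Type*} [NormedAddCommGroup F] [NormedSpace ℝ F] {U : Set E3} {x : E3}

/-- The partial derivative `∂ᵢ φ` of a vector-valued function on Euclidean three-space. -/
def partialDeriv (i : Fin 3) (φ : E3 → F) (x : E3) : F :=
  fderiv ℝ φ x (EuclideanSpace.single i 1)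

theorem pd_eq_partialDeriv (f : E3 → E3) (i : Fin 3) (x : E3) : pd f i x = partialDeriv i f x :=
  rfl

theorem partialDeriv_congr {φ ψ : E3 → F} (hU : IsOpen U) (h : ∀ y ∈ U, φ y = ψ y) (hx : x ∈ U)
    (i : Fin 3) : partialDeriv i φ x = partialDeriv i ψ x := by
  have : φ =ᶠ[𝓝 x] ψ := Filter.eventually_of_mem (hU.mem_nhds hx) h
  rw [partialDeriv, partialDeriv, this.fderiv_eq]

theorem partialDeriv_const (i : Fin 3) (c : F) : partialDeriv i (fun _ : E3 => c) x = 0 := by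
  simp [partialDeriv]

theorem partialDeriv_add {φ ψ : E3 → F} (hφ : DifferentiableAt ℝ φ x)
    (hψ : DifferentiableAt ℝ ψ x) (i : Fin 3) :
    partialDeriv i (fun y => φ y + ψ y) x = partialDeriv i φ x + partialDeriv i ψ x := by
  simp [partialDeriv, fderiv_fun_add hφ hψ]

theorem partialDeriv_sub {φ ψ : E3 → F} (hφ : DifferentiableAt ℝ φ x)
    (hψ : DifferentiableAt ℝ ψ x) (i : Fin 3) :
    partialDeriv i (fun y => φ y - ψ y) x = partialDeriv i φ x - partialDeriv i ψ x := by
  simp [partialDeriv, fderiv_fun_sub hφ hψ]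

theorem partialDeriv_const_smul {φ : E3 → F} (hφ : DifferentiableAt ℝ φ x) (c : ℝ) (i : Fin 3) :
    partialDeriv i (fun y => c • φ y) x = c • partialDeriv i φ x := by
  simp [partialDeriv, fderiv_fun_const_smul hφ]

theorem partialDeriv_const_mul {φ : E3 → ℝ} (hφ : DifferentiableAt ℝ φ x) (c : ℝ) (i : Fin 3) :
    partialDeriv i (fun y => c * φ y) x = c * partialDeriv i φ x :=
  partialDeriv_const_smul hφ c i

theorem partialDeriv_smul {c : E3 → ℝ} {φ : E3 → F} (hc : DifferentiableAt ℝ c x)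
    (hφ : DifferentiableAt ℝ φ x) (i : Fin 3) :
    partialDeriv i (fun y => c y • φ y) x
      = partialDeriv i c x • φ x + c x • partialDeriv i φ x := by
  simp [partialDeriv, fderiv_fun_smul hc hφ, add_comm]

theorem partialDeriv_mul {φ ψ : E3 → ℝ} (hφ : DifferentiableAt ℝ φ x)
    (hψ : DifferentiableAt ℝ ψ x) (i : Fin 3) :
    partialDeriv i (fun y => φ y * ψ y) x
      = partialDeriv i φ x * ψ x + φ x * partialDeriv i ψ x :=
  partialDeriv_smul hφ hψ i

theorem partialDeriv_inner {φ ψ : E3 → E3} (hφ : DifferentiableAt ℝ φ x)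
    (hψ : DifferentiableAt ℝ ψ x) (i : Fin 3) :
    partialDeriv i (fun y => inner ℝ (φ y) (ψ y)) x
      = inner ℝ (φ x) (partialDeriv i ψ x) + inner ℝ (partialDeriv i φ x) (ψ x) := by
  simp [partialDeriv, fderiv_inner_apply ℝ hφ hψ]

theorem differentiableAt_of_contDiffOn {φ : E3 → F} (hU : IsOpen U) (hφ : ContDiffOn ℝ ∞ φ U)
    (hx : x ∈ U) : DifferentiableAt ℝ φ x :=
  (hφ.contDiffAt (hU.mem_nhds hx)).differentiableAt (by simp)

theorem contDiffOn_partialDeriv {φ : E3 → F} (hU : IsOpen U) (hφ : ContDiffOn ℝ ∞ φ U)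
    (i : Fin 3) : ContDiffOn ℝ ∞ (partialDeriv i φ) U :=
  (hφ.fderiv_of_isOpen hU (m := ∞) (by simp)).clm_apply contDiffOn_const

theorem partialDeriv_comm {φ : E3 → F} (hU : IsOpen U) (hφ : ContDiffOn ℝ ∞ φ U) (hx : x ∈ U)
    (i j : Fin 3) :
    partialDeriv i (partialDeriv j φ) x = partialDeriv j (partialDeriv i φ) x := by
  have hs : IsSymmSndFDerivAt ℝ φ x :=
    (hφ.contDiffAt (hU.mem_nhds hx)).isSymmSndFDerivAt
      (by rw [minSmoothness_of_isRCLikeNormedField]; exact WithTop.coe_le_coe.2 le_top)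
  have hd : DifferentiableAt ℝ (fderiv ℝ φ) x :=
    differentiableAt_of_contDiffOn hU (hφ.fderiv_of_isOpen hU (m := ∞) (by simp)) hx
  have key : ∀ i j : Fin 3, partialDeriv i (partialDeriv j φ) x
      = fderiv ℝ (fderiv ℝ φ) x (EuclideanSpace.single i 1) (EuclideanSpace.single j 1) := by
    intro i j
    change fderiv ℝ (fun y => fderiv ℝ φ y (EuclideanSpace.single j 1)) x _ = _
    rw [fderiv_clm_apply hd (by fun_prop)]
    simp
  rw [key, key]
  exact hs _ _

theorem fderiv_apply_eq_sum_partialDeriv (φ : E3 → F) (x v : E3) :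
    fderiv ℝ φ x v = ∑ i, v i • partialDeriv i φ x := by
  have hv : v = ∑ i, v i • EuclideanSpace.single i (1 : ℝ) := by
    ext j
    fin_cases j <;> simp [Fin.sum_univ_three]
  conv_lhs => rw [hv]
  simp [partialDeriv]

/-- On a simply connected open set, smooth functions `aᵢ` with `∂ⱼ aᵢ = ∂ᵢ aⱼ` are the partial
derivatives of a smooth function. -/
theorem exists_partialDeriv_eq [CompleteSpace F] (hU : IsOpen U) (hUs : IsSimplyConnected U)
    {a : Fin 3 → E3 → F} (ha : ∀ i, ContDiffOn ℝ ∞ (a i) U)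
    (hc : ∀ x ∈ U, ∀ i j, i ≠ j → partialDeriv j (a i) x = partialDeriv i (a j) x) :
    ∃ g : E3 → F, ContDiffOn ℝ ∞ g U ∧ ∀ x ∈ U, ∀ i, partialDeriv i g x = a i x := by
  -- The one-form ∑ aᵢ dxᵢ.
  let η : E3 → E3 →L[ℝ] F := fun x =>
    ∑ i, (EuclideanSpace.proj i : E3 →L[ℝ] ℝ).smulRight (a i x)
  have hηs : ContDiffOn ℝ ∞ η U := ContDiffOn.sum fun i _ =>
    ((ContinuousLinearMap.smulRightL ℝ E3 F
      (EuclideanSpace.proj i : E3 →L[ℝ] ℝ)).contDiff).comp_contDiffOn (ha i)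
  have hη : DifferentiableOn ℝ η U := hηs.differentiableOn (by simp)
  have hη_apply : ∀ y v, η y v = ∑ i, v i • a i y := fun y v => by
    simp [η]
  have hfd : ∀ x ∈ U, ∀ u v, fderiv ℝ η x u v = ∑ i, v i • ∑ j, u j • partialDeriv j (a i) x := by
    intro x hx u v
    have h1 : fderiv ℝ (fun y => η y v) x u = fderiv ℝ η x u v := by
      rw [fderiv_clm_apply (hη.differentiableAt (hU.mem_nhds hx)) (by fun_prop)]
      simp
    rw [← h1]
    simp only [hη_apply]
    have hd : ∀ i, DifferentiableAt ℝ (a i) x := fun i =>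
      differentiableAt_of_contDiffOn hU (ha i) hx
    rw [fderiv_fun_sum (A := fun i y => v i • a i y) fun i _ => (hd i).const_smul (v i),
      _root_.sum_apply]
    refine Finset.sum_congr rfl fun i _ => ?_
    rw [fderiv_fun_const_smul (hd i), _root_.smul_apply,
      fderiv_apply_eq_sum_partialDeriv]
  have hc' : ∀ x ∈ U, ∀ i j, partialDeriv j (a i) x = partialDeriv i (a j) x := by
    intro x hx i j
    rcases eq_or_ne i j with rfl | h
    · rfl
    · exact hc x hx i j h
  obtain ⟨g, hg⟩ := exists_primitive_of_isSimplyConnected hU hUs hη (by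
    intro x hx u v
    rw [hfd x hx, hfd x hx]
    simp only [Finset.smul_sum]
    rw [Finset.sum_comm]
    refine Finset.sum_congr rfl fun i _ => Finset.sum_congr rfl fun j _ => ?_
    rw [hc' x hx, smul_comm])
  refine ⟨g, ?_, fun x hx i => ?_⟩
  · rw [contDiffOn_infty_iff_fderiv_of_isOpen hU]
    exact ⟨fun x hx => (hg x hx).differentiableAt.differentiableWithinAt,
      hηs.congr fun x hx => (hg x hx).fderiv⟩
  · rw [partialDeriv, (hg x hx).fderiv, hη_apply]
    rw [Finset.sum_eq_single i] <;> simp +contextual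

end Calculus

/-! ### The orthonormal frame of unit normals -/

section Frame

theorem inner_eq_sum (v w : E3) : inner ℝ v w = ∑ a, v a * w a := by
  simp [PiLp.inner_apply, mul_comm]

theorem eq_zero_of_inner_eq_zero {p : Fin 3 → E3}
    (hp : (Matrix.of fun a i : Fin 3 => p i a).det ≠ 0) {v : E3}
    (hv : ∀ i, inner ℝ v (p i) = 0) : v = 0 := by
  have h : Matrix.vecMul v.ofLp (Matrix.of fun a i : Fin 3 => p i a) = 0 := by
    ext i
    simpa [Matrix.vecMul, dotProduct, inner_eq_sum] using hv i
  have := Matrix.eq_zero_of_vecMul_eq_zero hp h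
  ext a
  simpa using congrFun this a

theorem inner_cross_self (p : Fin 3 → E3) (i : Fin 3) :
    inner ℝ (cross (p (i + 1)) (p (i + 2))) (p i)
      = (Matrix.of fun a i : Fin 3 => p i a).det := by
  fin_cases i <;>
  · simp [inner_eq_sum, cross, crossProduct, Fin.sum_univ_three, Matrix.det_fin_three]
    ring

theorem inner_cross_left (v w : E3) : inner ℝ (cross v w) v = 0 := by
  simp [inner_eq_sum, cross, crossProduct, Fin.sum_univ_three]
  ring

theorem inner_cross_right (v w : E3) : inner ℝ (cross v w) w = 0 := by
  simp [inner_eq_sum, cross, crossProduct, Fin.sum_univ_three]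
  ring

theorem cross_smul_smul (a b : ℝ) (v w : E3) :
    cross (a • v) (b • w) = (a * b) • cross v w := by
  ext i
  fin_cases i <;> simp [cross, crossProduct] <;> ring

theorem eq_or_eq_add (i j : Fin 3) : j = i ∨ j = i + 1 ∨ j = i + 2 := by
  revert i j; decide

variable {U V : Set E3} {f : E3 → E3} {x : E3}

theorem IsTriplyOrthogonalSystem.mono (hf : IsTriplyOrthogonalSystem U f) (hVU : V ⊆ U)
    (hV : IsOpen V) (hVc : IsConnected V) : IsTriplyOrthogonalSystem V f where
  isOpen := hV
  isConnected := hVc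
  smooth := hf.smooth.mono hVU
  det_ne_zero x hx := hf.det_ne_zero x (hVU hx)
  orthogonal x hx := hf.orthogonal x (hVU hx)

namespace IsTriplyOrthogonalSystem

/-- Both sides have the same inner products with the basis ∂₁f, ∂₂f, ∂₃f. Hence the normal Nᵢ is
parallel to ∂ᵢf. -/
theorem cross_eq (hf : IsTriplyOrthogonalSystem U f) (hx : x ∈ U) (i : Fin 3) :
    ‖pd f i x‖ ^ 2 • cross (pd f (i + 1) x) (pd f (i + 2) x) = jacobianDet f x • pd f i x := by
  rw [← sub_eq_zero]
  refine eq_zero_of_inner_eq_zero (p := fun i => pd f i x) (hf.det_ne_zero x hx) fun j => ?_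
  have h1 := inner_cross_self (fun i => pd f i x) i
  simp only [inner_sub_left, real_inner_smul_left]
  rcases eq_or_eq_add i j with rfl | rfl | rfl
  · rw [h1, real_inner_self_eq_norm_sq, jacobianDet]
    ring
  · rw [inner_cross_left, hf.orthogonal x hx i (i + 1) (by simp)]
    ring
  · rw [inner_cross_right, hf.orthogonal x hx i (i + 2) (by simp)]
    ring

theorem cross_ne_zero (hf : IsTriplyOrthogonalSystem U f) (hx : x ∈ U) (i : Fin 3) :
    cross (pd f (i + 1) x) (pd f (i + 2) x) ≠ 0 := by
  intro h
  have h1 := inner_cross_self (fun i => pd f i x) i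
  rw [h, inner_zero_left] at h1
  exact hf.det_ne_zero x hx h1.symm

/-- The scalar triple product is cyclic, so every Hᵢ carries the sign of the Jacobian determinant;
in particular Hᵢ may be negative. -/
theorem lame_eq (f : E3 → E3) (i : Fin 3) (x : E3) :
    lame f i x = ‖cross (pd f (i + 1) x) (pd f (i + 2) x)‖⁻¹ * jacobianDet f x := by
  rw [lame, lameAlong, unitNormal, real_inner_smul_right, real_inner_comm,
    inner_cross_self (fun i => pd f i x) i, jacobianDet]

theorem lame_ne_zero (hf : IsTriplyOrthogonalSystem U f) (hx : x ∈ U) (i : Fin 3) :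
    lame f i x ≠ 0 := by
  rw [lame_eq]
  exact mul_ne_zero (inv_ne_zero (norm_ne_zero_iff.2 (hf.cross_ne_zero hx i)))
    (hf.det_ne_zero x hx)

theorem norm_unitNormal (hf : IsTriplyOrthogonalSystem U f) (hx : x ∈ U) (i : Fin 3) :
    ‖unitNormal f i x‖ = 1 :=
  norm_smul_inv_norm (𝕜 := ℝ) (hf.cross_ne_zero hx i)

/-- `∂ᵢ f = Hᵢ Nᵢ`. -/
theorem pd_eq (hf : IsTriplyOrthogonalSystem U f) (hx : x ∈ U) (i : Fin 3) :
    pd f i x = lame f i x • unitNormal f i x := by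
  obtain ⟨c, hc⟩ : ∃ c : ℝ, pd f i x = c • unitNormal f i x := by
    have h := hf.cross_eq hx i
    have hn := norm_ne_zero_iff.2 (hf.cross_ne_zero hx i)
    have hd := hf.det_ne_zero x hx
    refine ⟨(jacobianDet f x)⁻¹ * ‖pd f i x‖ ^ 2
      * ‖cross (pd f (i + 1) x) (pd f (i + 2) x)‖, ?_⟩
    rw [unitNormal, smul_smul, mul_assoc, mul_inv_cancel₀ hn, mul_one, mul_smul, h, smul_smul,
      inv_mul_cancel₀ hd, one_smul]
  have : lame f i x = c := by
    rw [lame, lameAlong, hc, real_inner_smul_left, real_inner_self_eq_norm_sq,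
      hf.norm_unitNormal hx]
    ring
  rw [this, hc]

theorem inner_unitNormal (hf : IsTriplyOrthogonalSystem U f) (hx : x ∈ U) (i j : Fin 3) :
    inner ℝ (unitNormal f i x) (unitNormal f j x) = if i = j then (1 : ℝ) else 0 := by
  split_ifs with h
  · subst h
    rw [real_inner_self_eq_norm_sq, hf.norm_unitNormal hx]
    norm_num
  · have h1 := hf.orthogonal x hx i j h
    rw [hf.pd_eq hx, hf.pd_eq hx, real_inner_smul_left, real_inner_smul_right] at h1
    simpa [hf.lame_ne_zero hx] using h1

/-- A vector is determined by its components in the frame of unit normals. -/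
theorem ext_unitNormal (hf : IsTriplyOrthogonalSystem U f) (hx : x ∈ U) {v w : E3}
    (h : ∀ i, inner ℝ v (unitNormal f i x) = inner ℝ w (unitNormal f i x)) : v = w := by
  rw [← sub_eq_zero]
  refine eq_zero_of_inner_eq_zero (p := fun i => pd f i x) (hf.det_ne_zero x hx) fun i => ?_
  rw [hf.pd_eq hx, real_inner_smul_right, inner_sub_left, h i, sub_self, mul_zero]

theorem contDiffOn_unitNormal (hf : IsTriplyOrthogonalSystem U f) (i : Fin 3) :
    ContDiffOn ℝ ∞ (unitNormal f i) U := by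
  have hp : ∀ i a, ContDiffOn ℝ ∞ (fun y => pd f i y a) U := fun i a =>
    (EuclideanSpace.proj a : E3 →L[ℝ] ℝ).contDiff.comp_contDiffOn
      (contDiffOn_partialDeriv hf.isOpen hf.smooth i)
  have hc : ContDiffOn ℝ ∞ (fun y => cross (pd f (i + 1) y) (pd f (i + 2) y)) U := by
    rw [contDiffOn_euclidean]
    intro a
    fin_cases a <;> simp only [cross, crossProduct] <;>
      exact ((hp _ _).mul (hp _ _)).sub ((hp _ _).mul (hp _ _))
  exact ((hc.norm ℝ fun y hy => hf.cross_ne_zero hy i).inv fun y hy =>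
    norm_ne_zero_iff.2 (hf.cross_ne_zero hy i)).smul hc

theorem contDiffOn_lameAlong (hf : IsTriplyOrthogonalSystem U f) {g : E3 → E3}
    (hg : ContDiffOn ℝ ∞ g U) (i : Fin 3) : ContDiffOn ℝ ∞ (lameAlong f g i) U :=
  (contDiffOn_partialDeriv hf.isOpen hg i).inner ℝ (hf.contDiffOn_unitNormal i)

theorem contDiffOn_lame (hf : IsTriplyOrthogonalSystem U f) (i : Fin 3) :
    ContDiffOn ℝ ∞ (lame f i) U :=
  hf.contDiffOn_lameAlong hf.smooth i

end IsTriplyOrthogonalSystem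

end Frame

/-! ### Rotation coefficients, Lamé's equations and Combescure transforms -/

section

variable {U : Set E3} {f : E3 → E3} {x : E3}

/-- The rotation coefficient `βᵢₖ = ∂ₖ Hᵢ / Hₖ`. -/
def rotCoeff (f : E3 → E3) (i k : Fin 3) (x : E3) : ℝ :=
  partialDeriv k (lame f i) x / lame f k x

namespace IsTriplyOrthogonalSystem

theorem contDiffOn_rotCoeff (hf : IsTriplyOrthogonalSystem U f) (i k : Fin 3) :
    ContDiffOn ℝ ∞ (rotCoeff f i k) U :=
  (contDiffOn_partialDeriv hf.isOpen (hf.contDiffOn_lame i) k).div (hf.contDiffOn_lame k)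
    fun _ hx => hf.lame_ne_zero hx k

theorem partialDeriv_lame (hf : IsTriplyOrthogonalSystem U f) (hx : x ∈ U) (i k : Fin 3) :
    partialDeriv k (lame f i) x = rotCoeff f i k x * lame f k x :=
  (div_mul_cancel₀ _ (hf.lame_ne_zero hx k)).symm

theorem inner_partialDeriv_unitNormal_symm (hf : IsTriplyOrthogonalSystem U f) (hx : x ∈ U)
    (l m n : Fin 3) :
    inner ℝ (partialDeriv l (unitNormal f m) x) (unitNormal f n x)
      = - inner ℝ (partialDeriv l (unitNormal f n) x) (unitNormal f m x) := by
  have hd : ∀ i, DifferentiableAt ℝ (unitNormal f i) x := fun i =>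
    differentiableAt_of_contDiffOn hf.isOpen (hf.contDiffOn_unitNormal i) hx
  have h1 := partialDeriv_inner (hd m) (hd n) l
  rw [partialDeriv_congr hf.isOpen (fun y hy => hf.inner_unitNormal hy m n) hx,
    partialDeriv_const, real_inner_comm] at h1
  linarith

/-- Rodrigues' formula and Dupin's theorem: `∂ᵢ Nₖ = βᵢₖ Nᵢ` for `i ≠ k`. -/
theorem partialDeriv_unitNormal (hf : IsTriplyOrthogonalSystem U f) (hx : x ∈ U) {i k : Fin 3}
    (hik : i ≠ k) :
    partialDeriv i (unitNormal f k) x = rotCoeff f i k x • unitNormal f i x := by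
  have hN : ∀ i, DifferentiableAt ℝ (unitNormal f i) x := fun i =>
    differentiableAt_of_contDiffOn hf.isOpen (hf.contDiffOn_unitNormal i) hx
  have hH : ∀ i, DifferentiableAt ℝ (lame f i) x := fun i =>
    differentiableAt_of_contDiffOn hf.isOpen (hf.contDiffOn_lame i) hx
  have hne := fun i => hf.lame_ne_zero hx i
  have anti := hf.inner_partialDeriv_unitNormal_symm hx
  -- Component along Nₙ of ∂ₗ∂ₘf = ∂ₘ∂ₗf, with ∂ₘf = HₘNₘ.
  have sym : ∀ l m n : Fin 3,
      partialDeriv l (lame f m) x * (if m = n then 1 else 0)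
        + lame f m x * inner ℝ (partialDeriv l (unitNormal f m) x) (unitNormal f n x)
      = partialDeriv m (lame f l) x * (if l = n then 1 else 0)
        + lame f l x * inner ℝ (partialDeriv m (unitNormal f l) x) (unitNormal f n x) := by
    intro l m n
    have key : ∀ l m, partialDeriv l (partialDeriv m f) x
        = partialDeriv l (lame f m) x • unitNormal f m x
          + lame f m x • partialDeriv l (unitNormal f m) x := fun l m => by
      rw [← partialDeriv_smul (hH m) (hN m)]
      exact partialDeriv_congr hf.isOpen (fun y hy => hf.pd_eq hy m) hx l
    have h := congrArg (fun v => inner ℝ v (unitNormal f n x))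
      (partialDeriv_comm hf.isOpen hf.smooth hx l m)
    simpa only [key, inner_add_left, real_inner_smul_left, hf.inner_unitNormal hx] using h
  refine hf.ext_unitNormal hx fun n => ?_
  rw [real_inner_smul_left, hf.inner_unitNormal hx]
  by_cases hin : i = n
  · subst hin
    have h := sym i k i
    have h0 := anti k i i
    rw [hf.partialDeriv_lame hx i k, if_neg hik.symm, if_pos rfl] at h
    have h0' : inner ℝ (partialDeriv k (unitNormal f i) x) (unitNormal f i x) = 0 := by linarith
    rw [h0'] at h
    rw [if_pos rfl]
    apply mul_left_cancel₀ (hne k)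
    linarith
  · rw [if_neg hin, mul_zero]
    by_cases hkn : k = n
    · subst hkn
      have := anti i k k
      linarith
    · have h1 := sym i k n
      have h2 := sym i n k
      have h3 := sym k n i
      rw [if_neg hin, if_neg hkn] at h1
      rw [if_neg hik, if_neg (Ne.symm hkn)] at h2
      rw [if_neg (Ne.symm hik), if_neg (Ne.symm hin)] at h3
      rw [anti i n k, anti n i k] at h2
      rw [anti k n i] at h3
      -- For distinct indices, HₘHₙ(∂ₗNₘ, Nₙ) is symmetric in l, m and antisymmetric in m, n, hence
      -- zero: this is Dupin's theorem.
      have h4 : lame f k x * lame f n x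
          * inner ℝ (partialDeriv i (unitNormal f k) x) (unitNormal f n x) = 0 := by
        linear_combination (1 / 2 * lame f n x) * h1 - (1 / 2 * lame f k x) * h2
          - (1 / 2 * lame f i x) * h3
      simpa [hne] using h4

theorem partialDeriv_smul_unitNormal (hf : IsTriplyOrthogonalSystem U f) (hx : x ∈ U)
    {c : E3 → ℝ} (hc : DifferentiableAt ℝ c x) {i k : Fin 3} (hik : i ≠ k) :
    partialDeriv i (fun y => c y • unitNormal f k y) x
      = partialDeriv i c x • unitNormal f k x + (c x * rotCoeff f i k x) • unitNormal f i x := by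
  rw [partialDeriv_smul hc
    (differentiableAt_of_contDiffOn hf.isOpen (hf.contDiffOn_unitNormal k) hx),
    hf.partialDeriv_unitNormal hx hik, smul_smul]

/-- Lamé's equation `∂ⱼ βᵢₖ = βᵢⱼ βⱼₖ` for distinct `i, j, k`. -/
theorem partialDeriv_rotCoeff (hf : IsTriplyOrthogonalSystem U f) (hx : x ∈ U) {i j k : Fin 3}
    (hij : i ≠ j) (hik : i ≠ k) (hjk : j ≠ k) :
    partialDeriv j (rotCoeff f i k) x = rotCoeff f i j x * rotCoeff f j k x := by
  have key : ∀ {i j}, i ≠ j → i ≠ k → partialDeriv j (partialDeriv i (unitNormal f k)) x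
      = partialDeriv j (rotCoeff f i k) x • unitNormal f i x
        + (rotCoeff f i k x * rotCoeff f j i x) • unitNormal f j x := fun {i j} hij hik => by
    rw [← hf.partialDeriv_smul_unitNormal hx
      (differentiableAt_of_contDiffOn hf.isOpen (hf.contDiffOn_rotCoeff i k) hx) hij.symm]
    exact partialDeriv_congr hf.isOpen (fun y hy => hf.partialDeriv_unitNormal hy hik) hx j
  -- Lamé's equation is the Nᵢ-component of ∂ⱼ∂ᵢNₖ = ∂ᵢ∂ⱼNₖ.
  have h := congrArg (fun v => inner ℝ v (unitNormal f i x))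
    (partialDeriv_comm hf.isOpen (hf.contDiffOn_unitNormal k) hx j i)
  simp only [key hij hik, key hij.symm hjk, inner_add_left, real_inner_smul_left,
    hf.inner_unitNormal hx, if_neg hij.symm, if_pos] at h
  linarith

end IsTriplyOrthogonalSystem

/-- The system `∂ⱼ Gᵢ = βᵢⱼ Gⱼ`, `i ≠ j`, for the Lamé coefficients of Combescure transforms. -/
def IsCombescureSolution (U : Set E3) (f : E3 → E3) (G : Fin 3 → E3 → ℝ) : Prop :=
  (∀ i, ContDiffOn ℝ ∞ (G i) U) ∧
    ∀ x ∈ U, ∀ i j, i ≠ j → partialDeriv j (G i) x = rotCoeff f i j x * G j x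

namespace IsTriplyOrthogonalSystem

theorem lameAlong_eq_of_pd_eq (hf : IsTriplyOrthogonalSystem U f) (hx : x ∈ U) {g : E3 → E3}
    {c : ℝ} {i : Fin 3} (h : pd g i x = c • unitNormal f i x) : lameAlong f g i x = c := by
  rw [lameAlong, h, real_inner_smul_left, hf.inner_unitNormal hx, if_pos rfl, mul_one]

theorem pd_combescure_eq (hf : IsTriplyOrthogonalSystem U f) {g : E3 → E3}
    (hg : IsCombescureTransform U f g) (hx : x ∈ U) (i : Fin 3) :
    pd g i x = lameAlong f g i x • unitNormal f i x := by
  obtain ⟨-, h, hh⟩ := hg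
  have h1 : pd g i x = (h i x * lame f i x) • unitNormal f i x := by
    rw [hh x hx i, hf.pd_eq hx, smul_smul]
  rw [hf.lameAlong_eq_of_pd_eq hx h1, h1]

/-- The system is the Nᵢ-component of the equality of mixed second derivatives of g. -/
theorem isCombescureSolution_lameAlong (hf : IsTriplyOrthogonalSystem U f) {g : E3 → E3}
    (hg : IsCombescureTransform U f g) : IsCombescureSolution U f (lameAlong f g) := by
  refine ⟨hf.contDiffOn_lameAlong hg.1, fun x hx i j hij => ?_⟩
  have key : ∀ {i j}, i ≠ j → partialDeriv j (partialDeriv i g) x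
      = partialDeriv j (lameAlong f g i) x • unitNormal f i x
        + (lameAlong f g i x * rotCoeff f j i x) • unitNormal f j x := fun {i j} hij => by
    rw [← hf.partialDeriv_smul_unitNormal hx
      (differentiableAt_of_contDiffOn hf.isOpen (hf.contDiffOn_lameAlong hg.1 i) hx) hij.symm]
    exact partialDeriv_congr hf.isOpen (fun y hy => hf.pd_combescure_eq hg hy i) hx j
  have h := congrArg (fun v => inner ℝ v (unitNormal f i x))
    (partialDeriv_comm hf.isOpen hg.1 hx j i)
  simp only [key hij, key hij.symm, inner_add_left, real_inner_smul_left,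
    hf.inner_unitNormal hx, if_neg hij.symm, if_pos] at h
  linarith

/-- On simply connected domains, Combescure transforms can be prescribed by their Lamé
coefficients. -/
theorem exists_combescure (hf : IsTriplyOrthogonalSystem U f) (hU : IsSimplyConnected U)
    {G : Fin 3 → E3 → ℝ} (hG : IsCombescureSolution U f G) :
    ∃ g : E3 → E3, IsCombescureTransform U f g ∧ ∀ x ∈ U, ∀ i, lameAlong f g i x = G i x := by
  -- The system for G is precisely the closedness of the vector-valued form ∑ GᵢNᵢ dxᵢ.
  obtain ⟨g, hgs, hg⟩ := exists_partialDeriv_eq hf.isOpen hU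
    (a := fun i y => G i y • unitNormal f i y)
    (fun i => (hG.1 i).smul (hf.contDiffOn_unitNormal i)) (fun x hx i j hij => by
      rw [hf.partialDeriv_smul_unitNormal hx
          (differentiableAt_of_contDiffOn hf.isOpen (hG.1 i) hx) hij.symm,
        hf.partialDeriv_smul_unitNormal hx
          (differentiableAt_of_contDiffOn hf.isOpen (hG.1 j) hx) hij,
        hG.2 x hx i j hij, hG.2 x hx j i hij.symm, mul_comm (G i x), mul_comm (G j x), add_comm])
  refine ⟨g, ⟨hgs, fun i y => G i y / lame f i y, fun x hx i => ?_⟩, fun x hx i => ?_⟩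
  · rw [pd_eq_partialDeriv, hg x hx, hf.pd_eq hx, smul_smul,
      div_mul_cancel₀ _ (hf.lame_ne_zero hx i)]
  · exact hf.lameAlong_eq_of_pd_eq hx (hg x hx i)

end IsTriplyOrthogonalSystem

end

/-! ### The Guichard condition and the solution of (∗) -/

section

variable {U : Set E3} {f : E3 → E3} {x : E3}

theorem guichard_sum_eq {H : Fin 3 → ℝ} (h : H 0 ^ 2 + H 1 ^ 2 - H 2 ^ 2 = 0) (i : Fin 3) :
    eps i * H i ^ 2 + eps (i + 1) * H (i + 1) ^ 2 + eps (i + 2) * H (i + 2) ^ 2 = 0 := by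
  fin_cases i <;> simp [eps] <;> linarith

/-- The relations `Hᵢ Gⱼ - Hⱼ Gᵢ = εₖ Hₖ` force `H₁² + H₂² - H₃² = 0`. -/
theorem guichard_of_relation {H G : Fin 3 → ℝ}
    (h : ∀ i, H i * G (i + 1) - H (i + 1) * G i = eps (i + 2) * H (i + 2)) :
    H 0 ^ 2 + H 1 ^ 2 - H 2 ^ 2 = 0 := by
  have h0 := h 0
  have h1 := h 1
  have h2 := h 2
  simp [eps] at h0 h1 h2
  -- This is H · (H × G) = 0.
  linear_combination -H 0 * h1 - H 1 * h2 - H 2 * h0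

/-- A particular solution of the relations `Hᵢ Gⱼ - Hⱼ Gᵢ = εₖ Hₖ`. -/
def crossSolution (H : Fin 3 → ℝ) (i : Fin 3) : ℝ :=
  (eps (i + 1) - eps (i + 2)) * (H (i + 1) * H (i + 2)) / (H 0 ^ 2 + H 1 ^ 2 + H 2 ^ 2)

/-- `crossSolution` is (W × H)/|H|² with W = εH, and H × (W × H) = |H|²W because W ⊥ H by the
Guichard condition. -/
theorem crossSolution_relation {H : Fin 3 → ℝ} (h0 : H 0 ≠ 0)
    (h : H 0 ^ 2 + H 1 ^ 2 - H 2 ^ 2 = 0) (i : Fin 3) :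
    H i * crossSolution H (i + 1) - H (i + 1) * crossSolution H i = eps (i + 2) * H (i + 2) := by
  have hs : H 0 ^ 2 + H 1 ^ 2 + H 2 ^ 2 ≠ 0 := by positivity
  fin_cases i <;> simp [crossSolution, eps] <;> field_simp
  · linear_combination -H 2 * h
  · linear_combination -h
  · linear_combination -H 1 * h

theorem relation_all {H G : Fin 3 → ℝ}
    (h : ∀ i, H i * G (i + 1) - H (i + 1) * G i = eps (i + 2) * H (i + 2)) (i : Fin 3) :
    H (i + 1) * G (i + 2) - H (i + 2) * G (i + 1) = eps i * H i ∧
      H (i + 2) * G i - H i * G (i + 2) = eps (i + 1) * H (i + 1) := by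
  have h0 := h 0
  have h1 := h 1
  have h2 := h 2
  simp only [Fin.isValue, zero_add, Fin.reduceAdd] at h0 h1 h2
  fin_cases i <;> simp only [Fin.isValue, Fin.zero_eta, Fin.mk_one, Fin.reduceFinMk, zero_add,
    Fin.reduceAdd] <;> constructor <;> assumption

namespace IsTriplyOrthogonalSystem

theorem contDiffOn_crossSolution (hf : IsTriplyOrthogonalSystem U f) (i : Fin 3) :
    ContDiffOn ℝ ∞ (fun y => crossSolution (fun j => lame f j y) i) U := by
  have hH := hf.contDiffOn_lame
  refine (contDiffOn_const.mul ((hH _).mul (hH _))).div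
    ((((hH 0).pow 2).add ((hH 1).pow 2)).add ((hH 2).pow 2)) fun y hy => ?_
  have := hf.lame_ne_zero hy 0
  positivity

/-- For `(i, j, k)` cyclic, the derivative in direction `xₖ` of the relations
`Hᵢ Gⱼ - Hⱼ Gᵢ = εₖ Hₖ` gives `Hᵢ (∂ₖ Gⱼ - βⱼₖ Gₖ) = Hⱼ (∂ₖ Gᵢ - βᵢₖ Gₖ)`. -/
theorem relation_deriv (hf : IsTriplyOrthogonalSystem U f) {G : Fin 3 → E3 → ℝ}
    (hGs : ∀ i, ContDiffOn ℝ ∞ (G i) U)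
    (hrel : ∀ y ∈ U, ∀ i, lame f i y * G (i + 1) y - lame f (i + 1) y * G i y
      = eps (i + 2) * lame f (i + 2) y) (hx : x ∈ U) (i : Fin 3) :
    lame f i x * (rotCoeff f (i + 1) (i + 2) x * G (i + 2) x
        - partialDeriv (i + 2) (G (i + 1)) x)
      = lame f (i + 1) x * (rotCoeff f i (i + 2) x * G (i + 2) x
        - partialDeriv (i + 2) (G i) x) := by
  have hH : ∀ i, DifferentiableAt ℝ (lame f i) x := fun i =>
    differentiableAt_of_contDiffOn hf.isOpen (hf.contDiffOn_lame i) hx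
  have hG : ∀ i, DifferentiableAt ℝ (G i) x := fun i =>
    differentiableAt_of_contDiffOn hf.isOpen (hGs i) hx
  have h1 := partialDeriv_congr hf.isOpen (fun y hy => hrel y hy i) hx (i + 2)
  rw [partialDeriv_sub ((hH _).fun_mul (hG _)) ((hH _).fun_mul (hG _)),
    partialDeriv_mul (hH _) (hG _), partialDeriv_mul (hH _) (hG _),
    partialDeriv_const_mul (hH _), hf.partialDeriv_lame hx i,
    hf.partialDeriv_lame hx (i + 1)] at h1
  have hgui : ∀ y ∈ U, eps i * (lame f i y * lame f i y)
      + eps (i + 1) * (lame f (i + 1) y * lame f (i + 1) y)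
      + eps (i + 2) * (lame f (i + 2) y * lame f (i + 2) y) = 0 := fun y hy => by
    simpa only [sq] using guichard_sum_eq (H := fun j => lame f j y)
      (guichard_of_relation (G := fun j => G j y) (hrel y hy)) i
  have hm : ∀ i, DifferentiableAt ℝ (fun y => lame f i y * lame f i y) x := fun i =>
    (hH i).fun_mul (hH i)
  -- The derivative ∂ₖHₖ is not given by rotation coefficients; the derivative of the Guichard
  -- condition eliminates it from `h1`.
  have h2 := partialDeriv_congr hf.isOpen hgui hx (i + 2)
  rw [partialDeriv_const, partialDeriv_add (((hm _).const_mul _).fun_add ((hm _).const_mul _))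
      ((hm _).const_mul _),
    partialDeriv_add ((hm _).const_mul _) ((hm _).const_mul _), partialDeriv_const_mul (hm _),
    partialDeriv_const_mul (hm _), partialDeriv_const_mul (hm _), partialDeriv_mul (hH _) (hH _),
    partialDeriv_mul (hH _) (hH _), partialDeriv_mul (hH _) (hH _), hf.partialDeriv_lame hx i,
    hf.partialDeriv_lame hx (i + 1)] at h2
  obtain ⟨h3, h4⟩ := relation_all (H := fun j => lame f j x) (G := fun j => G j x) (hrel x hx) i
  apply mul_left_cancel₀ (hf.lame_ne_zero hx (i + 2))
  linear_combination (-lame f (i + 2) x) * h1 - 1 / 2 * h2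
    - (lame f (i + 2) x * rotCoeff f i (i + 2) x) * h3
    - (lame f (i + 2) x * rotCoeff f (i + 1) (i + 2) x) * h4

/-- The partial derivatives of a function `φ` for which the `Gᵢ + φ Hᵢ` are the Lamé coefficients
of a Combescure transform. -/
def correction (f : E3 → E3) (G : Fin 3 → E3 → ℝ) (k : Fin 3) (x : E3) : ℝ :=
  (rotCoeff f (k + 1) k x * G k x - partialDeriv k (G (k + 1)) x) / lame f (k + 1) x

theorem contDiffOn_correction (hf : IsTriplyOrthogonalSystem U f) {G : Fin 3 → E3 → ℝ}
    (hGs : ∀ i, ContDiffOn ℝ ∞ (G i) U) (k : Fin 3) : ContDiffOn ℝ ∞ (correction f G k) U :=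
  (((hf.contDiffOn_rotCoeff _ _).mul (hGs k)).sub
    (contDiffOn_partialDeriv hf.isOpen (hGs _) k)).div (hf.contDiffOn_lame _)
      fun _ hy => hf.lame_ne_zero hy _

/-- The definition of `correction` uses the row i = k + 1; `relation_deriv` says that the row i = k
+ 2 gives the same quotient. -/
theorem correction_mul_lame (hf : IsTriplyOrthogonalSystem U f) {G : Fin 3 → E3 → ℝ}
    (hGs : ∀ i, ContDiffOn ℝ ∞ (G i) U)
    (hrel : ∀ y ∈ U, ∀ i, lame f i y * G (i + 1) y - lame f (i + 1) y * G i y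
      = eps (i + 2) * lame f (i + 2) y) (hx : x ∈ U) {i k : Fin 3} (hik : i ≠ k) :
    correction f G k x * lame f i x = rotCoeff f i k x * G k x - partialDeriv k (G i) x := by
  have hne := hf.lame_ne_zero hx (k + 1)
  rcases eq_or_eq_add k i with rfl | rfl | rfl
  · exact absurd rfl hik
  · exact div_mul_cancel₀ _ hne
  · have h := hf.relation_deriv hGs hrel hx (k + 1)
    have e1 : k + 1 + 1 = k + 2 := by rw [add_assoc]; rfl
    have e2 : k + 1 + 2 = k := by rw [add_assoc]; exact add_zero k
    rw [e1, e2] at h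
    rw [correction, div_mul_eq_mul_div, div_eq_iff hne]
    linarith

/-- Differentiate the equation for ∂ₖφ in the row i of the third index. By Lamé's equation, Hᵢ times
the derivative becomes an expression symmetric in j and k. -/
theorem partialDeriv_correction_comm (hf : IsTriplyOrthogonalSystem U f) {G : Fin 3 → E3 → ℝ}
    (hGs : ∀ i, ContDiffOn ℝ ∞ (G i) U)
    (hrel : ∀ y ∈ U, ∀ i, lame f i y * G (i + 1) y - lame f (i + 1) y * G i y
      = eps (i + 2) * lame f (i + 2) y) (hx : x ∈ U) {j k : Fin 3} (hjk : j ≠ k) :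
    partialDeriv j (correction f G k) x = partialDeriv k (correction f G j) x := by
  obtain ⟨i, hij, hik⟩ : ∃ i : Fin 3, i ≠ j ∧ i ≠ k := by
    revert j k; decide
  have hd : ∀ {φ : E3 → ℝ}, ContDiffOn ℝ ∞ φ U → DifferentiableAt ℝ φ x := fun h =>
    differentiableAt_of_contDiffOn hf.isOpen h hx
  have key : ∀ {j k}, i ≠ j → i ≠ k → j ≠ k →
      partialDeriv j (correction f G k) x * lame f i x
          + correction f G k x * (rotCoeff f i j x * lame f j x)
        = rotCoeff f i j x * rotCoeff f j k x * G k x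
          + rotCoeff f i k x * (rotCoeff f k j x * G j x - correction f G j x * lame f k x)
          - partialDeriv j (partialDeriv k (G i)) x := fun {j k} hij hik hjk => by
    have h := partialDeriv_congr hf.isOpen
      (fun y hy => hf.correction_mul_lame hGs hrel hy hik) hx j
    have hβ := hd (hf.contDiffOn_rotCoeff i k)
    rw [partialDeriv_mul (hd (hf.contDiffOn_correction hGs k)) (hd (hf.contDiffOn_lame i)),
      partialDeriv_sub (hβ.fun_mul (hd (hGs k)))
        (hd (contDiffOn_partialDeriv hf.isOpen (hGs i) k)),
      partialDeriv_mul hβ (hd (hGs k)), hf.partialDeriv_rotCoeff hx hij hik hjk,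
      hf.partialDeriv_lame hx] at h
    rw [h, hf.correction_mul_lame hGs hrel hx hjk.symm]
    ring
  have h1 := key hij hik hjk
  have h2 := key hik hij hjk.symm
  rw [partialDeriv_comm hf.isOpen (hGs i) hx k j] at h2
  apply mul_right_cancel₀ (hf.lame_ne_zero hx i)
  linear_combination h1 - h2

/-- A Guichard net on a simply connected domain has a Combescure transform with
`Hᵢ Ĥⱼ - Hⱼ Ĥᵢ = εₖ Hₖ`. -/
theorem exists_lameRelation (hf : IsTriplyOrthogonalSystem U f) (hU : IsSimplyConnected U)
    (hgui : ∀ x ∈ U, lame f 0 x ^ 2 + lame f 1 x ^ 2 - lame f 2 x ^ 2 = 0) :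
    ∃ g : E3 → E3, IsCombescureTransform U f g ∧ LameRelation U f g := by
  let G : Fin 3 → E3 → ℝ := fun i y => crossSolution (fun j => lame f j y) i
  have hGs : ∀ i, ContDiffOn ℝ ∞ (G i) U := hf.contDiffOn_crossSolution
  have hrel : ∀ y ∈ U, ∀ i, lame f i y * G (i + 1) y - lame f (i + 1) y * G i y
      = eps (i + 2) * lame f (i + 2) y := fun y hy i =>
    crossSolution_relation (H := fun j => lame f j y) (hf.lame_ne_zero hy 0) (hgui y hy) i
  -- Adding φH leaves (∗) intact, since its left side is antisymmetric in H and G; φ is chosen to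
  -- make G + φH solve the linear system.
  obtain ⟨φ, hφs, hφ⟩ := exists_partialDeriv_eq hf.isOpen hU
    (hf.contDiffOn_correction hGs)
    (fun x hx i j hij => hf.partialDeriv_correction_comm hGs hrel hx hij.symm)
  obtain ⟨g, hg, hgl⟩ := hf.exists_combescure hU (G := fun i y => G i y + φ y * lame f i y)
    ⟨fun i => (hGs i).add (hφs.mul (hf.contDiffOn_lame i)), fun x hx i j hij => by
      have hd : ∀ {φ : E3 → ℝ}, ContDiffOn ℝ ∞ φ U → DifferentiableAt ℝ φ x := fun h =>
        differentiableAt_of_contDiffOn hf.isOpen h hx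
      rw [partialDeriv_add (hd (hGs i)) ((hd hφs).fun_mul (hd (hf.contDiffOn_lame i))),
        partialDeriv_mul (hd hφs) (hd (hf.contDiffOn_lame i)), hφ x hx j,
        hf.correction_mul_lame hGs hrel hx hij, hf.partialDeriv_lame hx]
      ring⟩
  refine ⟨g, hg, fun x hx i => ?_⟩
  rw [hgl x hx, hgl x hx]
  linear_combination hrel x hx i

end IsTriplyOrthogonalSystem

end

/-! ### The dual system and the curvature relation -/

section

variable {U : Set E3} {f g : E3 → E3} {x : E3}

theorem eps_mul_self (i : Fin 3) : eps i * eps i = 1 := by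
  fin_cases i <;> simp [eps]

theorem eps_ne_zero (i : Fin 3) : eps i ≠ 0 := fun h => by
  simpa [h] using eps_mul_self i

/-- Each εᵢ is its own inverse, and ε₁ε₂ε₃ = -1. -/
theorem eps_mul_succ (i : Fin 3) : eps (i + 2) * eps i = - eps (i + 1) ∧
    eps (i + 2) * eps (i + 1) = - eps i := by
  fin_cases i <;> simp [eps]

/-- By (∗) the left side is Hₖ² for the third index k, and the Guichard condition expresses Hₖ²
through Hᵢ² and Hⱼ². -/
theorem relation_sq {H G : Fin 3 → ℝ}
    (h : ∀ i, H i * G (i + 1) - H (i + 1) * G i = eps (i + 2) * H (i + 2)) {i j : Fin 3}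
    (hij : i ≠ j) : (H i * G j - H j * G i) ^ 2 = eps i * H j ^ 2 + eps j * H i ^ 2 := by
  have key : ∀ i, (H i * G (i + 1) - H (i + 1) * G i) ^ 2
      = eps i * H (i + 1) ^ 2 + eps (i + 1) * H i ^ 2 := fun i => by
    have h1 := guichard_sum_eq (guichard_of_relation h) i
    obtain ⟨h2, h3⟩ := eps_mul_succ i
    rw [h i]
    linear_combination eps (i + 2) * h1 - H i ^ 2 * h2 - H (i + 1) ^ 2 * h3
  rcases eq_or_eq_add i j with rfl | rfl | rfl
  · exact absurd rfl hij
  · exact key i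
  · have h1 := key (i + 2)
    have e : i + 2 + 1 = i := by rw [add_assoc]; exact add_zero i
    rw [e] at h1
    linear_combination h1

namespace IsTriplyOrthogonalSystem

/-- Rodrigues' formula gives κᵢⱼ = -βⱼᵢ/Ĥⱼ. Where Ĥⱼ = 0 or βⱼᵢ = 0, both sides are zero by
convention. -/
theorem curvatureRadius_eq (hf : IsTriplyOrthogonalSystem U f) (hg : IsCombescureTransform U f g)
    (hx : x ∈ U) {i j : Fin 3} (hij : i ≠ j) :
    curvatureRadius f g i j x = - lameAlong f g j x / rotCoeff f j i x := by
  have hpd := hf.pd_combescure_eq hg hx j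
  have hN : unitNormal f j x ≠ 0 := by
    rw [← norm_ne_zero_iff, hf.norm_unitNormal hx]
    exact one_ne_zero
  rw [curvatureRadius]
  split_ifs with h
  · rw [hpd, smul_eq_zero, or_iff_left hN] at h
    simp [h]
  · have hG : lameAlong f g j x ≠ 0 := fun h0 => h (by rw [hpd, h0, zero_smul])
    have hN1 : pd (unitNormal f i) j x = rotCoeff f j i x • unitNormal f j x :=
      hf.partialDeriv_unitNormal hx hij.symm
    rw [principalCurvature, hN1, hpd, norm_smul, hf.norm_unitNormal hx, real_inner_smul_left,
      real_inner_smul_right, hf.inner_unitNormal hx, if_pos rfl, Real.norm_eq_abs, mul_one,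
      mul_one, sq_abs, inv_div, div_neg, neg_div, sq, mul_div_mul_right _ _ hG]

/-- Differentiating H⋆ᵢHᵢ = εᵢ - Ĥᵢ² reduces the system to HᵢH⋆ⱼ + HⱼH⋆ᵢ = -2ĤᵢĤⱼ, which is
`relation_sq` in other terms. -/
theorem isCombescureSolution_dual (hf : IsTriplyOrthogonalSystem U f)
    (hg : IsCombescureTransform U f g) (hrel : LameRelation U f g) :
    IsCombescureSolution U f (fun i y => (eps i - lameAlong f g i y ^ 2) / lame f i y) := by
  obtain ⟨hGs, hG⟩ := hf.isCombescureSolution_lameAlong hg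
  have hSs : ∀ i, ContDiffOn ℝ ∞ (fun y => (eps i - lameAlong f g i y ^ 2) / lame f i y) U :=
    fun i => (contDiffOn_const.sub ((hGs i).pow 2)).div (hf.contDiffOn_lame i)
      fun y hy => hf.lame_ne_zero hy i
  refine ⟨hSs, fun x hx i j hij => ?_⟩
  have hd : ∀ {φ : E3 → ℝ}, ContDiffOn ℝ ∞ φ U → DifferentiableAt ℝ φ x := fun h =>
    differentiableAt_of_contDiffOn hf.isOpen h hx
  have hmul : ∀ i, ∀ y ∈ U, (eps i - lameAlong f g i y ^ 2) / lame f i y * lame f i y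
      = eps i - lameAlong f g i y * lameAlong f g i y := fun i y hy => by
    rw [div_mul_cancel₀ _ (hf.lame_ne_zero hy i), sq]
  have h1 := partialDeriv_congr hf.isOpen (hmul i) hx j
  rw [partialDeriv_mul (hd (hSs i)) (hd (hf.contDiffOn_lame i)),
    partialDeriv_sub (differentiableAt_const _) ((hd (hGs i)).fun_mul (hd (hGs i))),
    partialDeriv_const, partialDeriv_mul (hd (hGs i)) (hd (hGs i)), hG x hx i j hij,
    hf.partialDeriv_lame hx] at h1
  have h2 := relation_sq (H := fun i => lame f i x) (G := fun i => lameAlong f g i x)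
    (hrel x hx) hij
  have hi := hmul i x hx
  have hj := hmul j x hx
  set Si := (eps i - lameAlong f g i x ^ 2) / lame f i x
  set Sj := (eps j - lameAlong f g j x ^ 2) / lame f j x
  apply mul_left_cancel₀ (mul_ne_zero (pow_ne_zero 2 (hf.lame_ne_zero hx i))
    (hf.lame_ne_zero hx j))
  linear_combination (lame f i x * lame f j x) * h1
    - (rotCoeff f i j x * lame f j x ^ 2) * hi - (rotCoeff f i j x * lame f i x ^ 2) * hj
    + rotCoeff f i j x * h2

theorem isAssociatedSystem (hf : IsTriplyOrthogonalSystem U f) (hU : IsSimplyConnected U)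
    (hg : IsCombescureTransform U f g) (hrel : LameRelation U f g) :
    IsAssociatedSystem U f g := by
  obtain ⟨s, hs, hS⟩ := hf.exists_combescure hU (hf.isCombescureSolution_dual hg hrel)
  -- Non-triviality holds since h⋆ⱼ + hⱼ² = εⱼ/Hⱼ² never vanishes.
  refine ⟨hf, hg, s, hs, fun x hx i => Or.inl fun h => ?_, fun x hx i => ?_⟩
  · have hne := hf.lame_ne_zero hx (i + 1)
    rw [combFactor, combFactor, hS x hx] at h
    field_simp at h
    exact eps_ne_zero (i + 1) (by linarith)
  · have h12 : i + 1 ≠ i + 2 := by revert i; decide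
    have h1 := hf.lame_ne_zero hx (i + 1)
    have h2 := hf.lame_ne_zero hx (i + 2)
    have hsq := relation_sq (H := fun i => lame f i x) (G := fun i => lameAlong f g i x)
      (hrel x hx) h12
    have key : lame f (i + 1) x * lameAlong f s (i + 2) x
        + lame f (i + 2) x * lameAlong f s (i + 1) x
        = -2 * (lameAlong f g (i + 1) x * lameAlong f g (i + 2) x) := by
      rw [hS x hx, hS x hx]
      field_simp
      linear_combination -hsq
    constructor
    · intro _ _
      have hff : IsCombescureTransform U f f := ⟨hf.smooth, fun _ _ => 1, by simp⟩
      have hi1 : i ≠ i + 1 := by simp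
      have hi2 : i ≠ i + 2 := by simp
      rw [hf.curvatureRadius_eq hff hx hi1, hf.curvatureRadius_eq hff hx hi2,
        hf.curvatureRadius_eq hg hx hi1, hf.curvatureRadius_eq hg hx hi2,
        hf.curvatureRadius_eq hs hx hi1, hf.curvatureRadius_eq hs hx hi2]
      simp only [lame] at key
      -- All radii are -(Lamé coefficient)/β, so the relation is `key` divided by the two rotation
      -- coefficients.
      linear_combination ((rotCoeff f (i + 1) i x)⁻¹ * (rotCoeff f (i + 2) i x)⁻¹) * key
    · rw [combFactor, combFactor, combFactor, combFactor]
      field_simp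
      linear_combination key

/-! ### Non-degenerate transforms near a point -/

/-- A Combescure transform with positive factors `hᵢ` is a triply orthogonal system with the same
unit normals. -/
theorem of_pd_eq_pos_smul (hf : IsTriplyOrthogonalSystem U f) (hg : ContDiffOn ℝ ∞ g U)
    {m : Fin 3 → E3 → ℝ} (hm : ∀ x ∈ U, ∀ i, 0 < m i x)
    (hpd : ∀ x ∈ U, ∀ i, pd g i x = m i x • pd f i x) :
    IsTriplyOrthogonalSystem U g ∧ ∀ x ∈ U, ∀ i, unitNormal g i x = unitNormal f i x := by
  refine ⟨⟨hf.isOpen, hf.isConnected, hg, fun x hx => ?_, fun x hx i j hij => ?_⟩,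
    fun x hx i => ?_⟩
  · have h1 := inner_cross_self (fun i => pd g i x) 0
    have h2 := inner_cross_self (fun i => pd f i x) 0
    simp only [hpd x hx, cross_smul_smul, real_inner_smul_left, real_inner_smul_right] at h1
    rw [h2] at h1
    have h3 : jacobianDet g x = (m (0 + 1) x * m (0 + 2) x) * (m 0 x * jacobianDet f x) := by
      simp only [jacobianDet, hpd x hx]
      linarith
    rw [h3]
    exact mul_ne_zero (mul_pos (hm x hx _) (hm x hx _)).ne'
      (mul_ne_zero (hm x hx _).ne' (hf.det_ne_zero x hx))
  · rw [hpd x hx, hpd x hx, real_inner_smul_left, real_inner_smul_right,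
      hf.orthogonal x hx i j hij, mul_zero, mul_zero]
  · have hp := mul_pos (hm x hx (i + 1)) (hm x hx (i + 2))
    rw [unitNormal, unitNormal, hpd x hx, hpd x hx, cross_smul_smul, norm_smul,
      Real.norm_of_nonneg hp.le, mul_inv, smul_smul, mul_right_comm, inv_mul_cancel₀ hp.ne',
      one_mul]

/-- A Combescure transform of `f` becomes a non-degenerate one near a given point by adding a
large multiple of `f`; this preserves the relations `Hᵢ Ĥⱼ - Hⱼ Ĥᵢ = εₖ Hₖ`. -/
theorem exists_nondegenerate (hf : IsTriplyOrthogonalSystem U f) (hg : IsCombescureTransform U f g)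
    (hrel : LameRelation U f g) {p : E3} (hp : p ∈ U) :
    ∃ V : Set E3, p ∈ V ∧ V ⊆ U ∧ ∃ g : E3 → E3, IsTriplyOrthogonalSystem V g ∧
      IsCombescureTransform V f g ∧
      (∀ x ∈ V, ∀ i : Fin 3, unitNormal g i x = unitNormal f i x ∧
        lameAlong f g i x = lame g i x) ∧ LameRelation V f g := by
  obtain ⟨c, hcp⟩ : ∃ c : ℝ, ∀ i, 0 < combFactor f g i p + c := by
    -- This c makes all hᵢ + c positive at p, hence on a ball around p by continuity.
    refine ⟨1 + ∑ i, |combFactor f g i p|, fun i => ?_⟩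
    have h1 := neg_abs_le (combFactor f g i p)
    have h2 := Finset.single_le_sum (f := fun i => |combFactor f g i p|)
      (fun i _ => abs_nonneg _) (Finset.mem_univ i)
    linarith
  have hcont : ∀ i, ContinuousAt (fun y => combFactor f g i y + c) p := fun i =>
    (((hf.contDiffOn_lameAlong hg.1 i).div (hf.contDiffOn_lame i)
      fun _ hy => hf.lame_ne_zero hy i).continuousOn.continuousAt
        (hf.isOpen.mem_nhds hp)).add continuousAt_const
  have hev : ∀ᶠ y in 𝓝 p, y ∈ U ∧ ∀ i, 0 < combFactor f g i y + c :=
    (hf.isOpen.eventually_mem hp).and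
      (Filter.eventually_all.2 fun i => (hcont i).eventually (lt_mem_nhds (hcp i)))
  obtain ⟨r, hr, hV⟩ := Metric.eventually_nhds_iff_ball.1 hev
  have hVU : Metric.ball p r ⊆ U := fun y hy => (hV y hy).1
  have hfV := hf.mono hVU Metric.isOpen_ball
    ((convex_ball p r).isConnected (Metric.nonempty_ball.2 hr))
  have hpd : ∀ x ∈ U, ∀ i, pd (fun y => g y + c • f y) i x = pd g i x + c • pd f i x := by
    intro x hx i
    have h1 := differentiableAt_of_contDiffOn hf.isOpen hg.1 hx
    have h2 := differentiableAt_of_contDiffOn hf.isOpen hf.smooth hx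
    simp only [pd_eq_partialDeriv]
    rw [partialDeriv_add h1 (h2.fun_const_smul c), partialDeriv_const_smul h2]
  have hpd' : ∀ x ∈ Metric.ball p r, ∀ i,
      pd (fun y => g y + c • f y) i x = (combFactor f g i x + c) • pd f i x := by
    intro x hx i
    rw [hpd x (hVU hx), add_smul, hf.pd_combescure_eq hg (hVU hx), hf.pd_eq (hVU hx),
      smul_smul (combFactor f g i x), combFactor, div_mul_cancel₀ _ (hf.lame_ne_zero (hVU hx) i)]
  have hsm : ContDiffOn ℝ ∞ (fun y => g y + c • f y) (Metric.ball p r) :=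
    (hg.1.mono hVU).add ((hf.smooth.mono hVU).const_smul c)
  obtain ⟨hsys, hN⟩ := hfV.of_pd_eq_pos_smul hsm (fun x hx => (hV x hx).2) hpd'
  refine ⟨Metric.ball p r, Metric.mem_ball_self hr, hVU, fun y => g y + c • f y, hsys,
    ⟨hsm, _, hpd'⟩, fun x hx i => ⟨hN x hx i, ?_⟩, fun x hx i => ?_⟩
  · rw [lame, lameAlong, lameAlong, hN x hx]
  · have hl : ∀ i, lameAlong f (fun y => g y + c • f y) i x
        = lameAlong f g i x + c * lame f i x := fun i => by
      rw [lameAlong, hpd x (hVU hx), inner_add_left, real_inner_smul_left]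
      rfl
    rw [hl, hl]
    linear_combination hrel x (hVU hx) i

end IsTriplyOrthogonalSystem

theorem isGuichardNet_of_lameRelation (hf : IsTriplyOrthogonalSystem U f)
    (hrel : LameRelation U f g) : IsGuichardNet U f :=
  ⟨hf, fun x hx => guichard_of_relation (H := fun i => lame f i x)
    (G := fun i => lameAlong f g i x) (hrel x hx)⟩

/-- A ball around p is simply connected, so the global existence result applies there before
shrinking to a non-degenerate transform. -/
theorem IsGuichardNet.exists_nondegenerate (h : IsGuichardNet U f) {p : E3} (hp : p ∈ U) :
    ∃ V : Set E3, p ∈ V ∧ V ⊆ U ∧ ∃ g : E3 → E3, IsTriplyOrthogonalSystem V g ∧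
      IsCombescureTransform V f g ∧
      (∀ x ∈ V, ∀ i : Fin 3, unitNormal g i x = unitNormal f i x ∧
        lameAlong f g i x = lame g i x) ∧ LameRelation V f g := by
  obtain ⟨hf, hgui⟩ := h
  obtain ⟨r, hr, hB⟩ := Metric.isOpen_iff.1 hf.isOpen p hp
  have hne : (Metric.ball p r).Nonempty := Metric.nonempty_ball.2 hr
  have hfB := hf.mono hB Metric.isOpen_ball ((convex_ball p r).isConnected hne)
  have hsc : IsSimplyConnected (Metric.ball p r) := by
    have := (convex_ball p r).contractibleSpace hne
    exact SimplyConnectedSpace.ofContractible _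
  obtain ⟨g, hg, hrel⟩ := hfB.exists_lameRelation hsc fun x hx => hgui x (hB hx)
  obtain ⟨V, hpV, hV, h⟩ := hfB.exists_nondegenerate hg hrel (Metric.mem_ball_self hr)
  exact ⟨V, hpV, hV.trans hB, h⟩

end

end TriplyOrthogonal

end

theorem mainTheorem6 (U : Set TriplyOrthogonal.E3)
    (f : TriplyOrthogonal.E3 → TriplyOrthogonal.E3)
    (hf : TriplyOrthogonal.IsTriplyOrthogonalSystem U f) :
    -- on a simply connected domain: the characterization by a (possibly degenerate) transform
    (IsSimplyConnected U →
      (TriplyOrthogonal.IsGuichardNet U f ↔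
        ∃ g : TriplyOrthogonal.E3 → TriplyOrthogonal.E3,
          TriplyOrthogonal.IsCombescureTransform U f g ∧
          TriplyOrthogonal.LameRelation U f g)) ∧
    -- on any domain: the existence of a transform suffices
    ((∃ g : TriplyOrthogonal.E3 → TriplyOrthogonal.E3,
        TriplyOrthogonal.IsCombescureTransform U f g ∧
        TriplyOrthogonal.LameRelation U f g) →
      TriplyOrthogonal.IsGuichardNet U f) ∧
    -- on any domain: the local characterization by non-degenerate triply orthogonal systems
    (TriplyOrthogonal.IsGuichardNet U f ↔
      ∀ p ∈ U, ∃ V : Set TriplyOrthogonal.E3, p ∈ V ∧ V ⊆ U ∧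
        ∃ g : TriplyOrthogonal.E3 → TriplyOrthogonal.E3,
          TriplyOrthogonal.IsTriplyOrthogonalSystem V g ∧
          TriplyOrthogonal.IsCombescureTransform V f g ∧
          (∀ x ∈ V, ∀ i : Fin 3,
            TriplyOrthogonal.unitNormal g i x = TriplyOrthogonal.unitNormal f i x ∧
            TriplyOrthogonal.lameAlong f g i x = TriplyOrthogonal.lame g i x) ∧
          TriplyOrthogonal.LameRelation V f g) ∧
    -- such a transform is an associated system
    (∀ V : Set TriplyOrthogonal.E3, V ⊆ U → IsOpen V → IsSimplyConnected V →
      ∀ g : TriplyOrthogonal.E3 → TriplyOrthogonal.E3,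
        TriplyOrthogonal.IsCombescureTransform V f g →
        TriplyOrthogonal.LameRelation V f g →
        TriplyOrthogonal.IsAssociatedSystem V f g) := by
  refine ⟨fun hU => ⟨fun h => hf.exists_lameRelation hU h.2, fun ⟨g, _, hrel⟩ =>
      TriplyOrthogonal.isGuichardNet_of_lameRelation hf hrel⟩,
    fun ⟨g, _, hrel⟩ => TriplyOrthogonal.isGuichardNet_of_lameRelation hf hrel,
    ⟨fun h p hp => h.exists_nondegenerate hp, fun h => ⟨hf, fun x hx => ?_⟩⟩,
    fun V hVU hVo hVs g hg hrel =>
      (hf.mono hVU hVo hVs.isPathConnected.isConnected).isAssociatedSystem hVs hg hrel⟩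
  -- The Guichard condition is pointwise, so (∗) at x itself suffices.
  obtain ⟨V, hxV, -, g, -, -, -, hrel⟩ := h x hx
  exact TriplyOrthogonal.guichard_of_relation (H := fun i => TriplyOrthogonal.lame f i x)
    (G := fun i => TriplyOrthogonal.lameAlong f g i x) (hrel x hxV)
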